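/- **Notation.** Let $F=\{(x,y,z)\in\mathbb Z^3:\ x+y+z\in\{0,1,2\}\}$ and let $e_1,e_2,e_3$ be the standard basis of $\mathbb Z^3$. For every $p=(x,y,z)\in\mathbb Z^3$ there is exactly one point $\bar p=p-\lfloor\frac{x+y+z}{3}\rfloor(1,1,1)$ of $F$ with the same orthogonal projection onto $(1,1,1)^\perp$ as $p$. Given initial data $t:F\to R^\times$ with values in the units of a commutative ring $R$, a *solution* is a function $\theta:\mathbb Z^3\to R$ with $\theta_p=t_p$ for $p\in F$ and $$\theta_{x,y,z}\,\theta_{x+1,y+1,z+1}=\theta_{x+1,y,z}\,\theta_{x,y+1,z+1}+\theta_{x,y+1,z}\,\theta_{x+1,y,z+1}\qquad(x+y+z\ge 0).$$ Let $(a,b,c)\in\mathbb Z^3$ with $N:=a+b+c-2\ge 1$. For $1\le i\le 3N-1$ and $p,q,r\in\mathbb Z^3$ let $V_i(p,q,r)$ be the $3N\times 3N$ matrix equal to the identity except for the block in rows and columns $i,i+1$, which is $\begin{pmatrix} t_{\bar q}/t_{\bar r} & t_{\bar p}/t_{\bar r}\\ 0&1\end{pmatrix}$. ($V_i(p,q,r)$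 is the matrix of a lozenge whose lower, gray triangle has bottom, left and right vertices $p,q,r$.) A hexagon with centre $p$ has the matrix $$H_i(p)=V_{i+1}(p+e_2,\,p+e_2+e_3,\,p)\;V_i(p+e_1+e_2,\,p+e_2,\,p+e_1)\;V_{i+1}(p+e_1,\,p,\,p+e_1+e_3).$$ The augmented shadow $\mathcal S_{a,b,c}$ consists of the $\binom{N+1}2$ hexagons centred at the points $p_{r,s}=(a-1-r+s,\ b-1-s,\ c-N+r)$, $0\le s\le r\le N-1$ (these are all the points with $x+y+z=0$, $x<a$, $y<b$, $z<c$), with matrices $H_{2r+1}(p_{r,s})$, and of $\binom N2$ additional lozenges on top, with matrices $E_{k,s}=V_{2N+k}(q,\ q-e_1,\ q-e_2)$, $q=(a-N+s-k+1,\ b-s,\ c)$, $1\le k\le s\le N-1$. Its matrix is the product, from left to right, $$M_{\mathcal S_{a,b,c}}=\prod_{s=0}^{N-1}\Big(E_{s,s}\,E_{s-1,s}\cdots E_{1,s}\;H_{2N-1}(p_{N-1,s})\,H_{2N-3}(p_{N-2,s})\cdots H_{2s+1}(p_{s,s})\Big).$$ Let $\sigma_i$ and $\tau_i$ ($1\le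 i\le 3N+1$) be the initial data along its West and East borders, read from bottom to top: $$\sigma_i=t_{\overline{(a-\lfloor i/2\rfloor,\ b,\ c-N+\lfloor (i-1)/2\rfloor)}},\quad \tau_i=t_{\overline{(a,\ b-\lfloor i/2\rfloor,\ c-N+\lfloor (i-1)/2\rfloor)}}\qquad(1\le i\le 2N+1),$$ $$\sigma_{2N+1+k}=t_{\overline{(a-N,\ b-k,\ c)}},\quad \tau_{2N+1+k}=t_{\overline{(a-k,\ b-N,\ c)}}\qquad(1\le k\le N).$$ **Theorem.** (i) Let $R$ be a commutative ring, $t:F\to R^\times$, and let $\theta$ be a solution with initial data $t$ such that $\theta_{x,y,z}$ is not a zero divisor whenever $x+y+z\ge 0$. Then for all $(a,b,c)\in\mathbb Z^3$ with $N=a+b+c-2\ge 1$, $$\theta_{a,b,c}=\Big(\prod_{i=N+2}^{2N}\sigma_i^{-1}\ \prod_{j=2N+1}^{3N}\tau_j\Big)\ \big|M_{\mathcal S_{a,b,c}}\big|_{N+1,N+2,\dots,2N}^{2N+1,2N+2,\dots,3N},\qquad(*)$$ where $|M|_{I}^{J}$ is the minor of $M$ with rows $I$ and columns $J$. (ii)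 For formal initial data, that is, when $R$ is the field of rational functions over $\mathbb Q$ in independent variables $t_p$ $(p\in F)$, a solution exists, and every solution satisfies $(*)$ for all $(a,b,c)\in\mathbb Z^3$ with $N=a+b+c-2\ge1$. -/

import Mathlib

open scoped Matrix

/-- The points of the cubic lattice `ℤ³`. -/
abbrev Pt : Type := ℤ × ℤ × ℤ

/-- The vertices of the flat initial data surface: the lattice points on the three planes
`x + y + z = 0`, `x + y + z = 1` and `x + y + z = 2`. -/
abbrev FlatPt : Type := {p : Pt // 0 ≤ p.1 + p.2.1 + p.2.2 ∧ p.1 + p.2.1 + p.2.2 ≤ 2}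

/-- The unique vertex of the flat surface with the same orthogonal projection onto the plane
`(1,1,1)^⊥` as `p`: it is `p - m • (1,1,1)` with `m = ⌊(x + y + z) / 3⌋`. It is `p` itself when `p`
is a vertex of the flat surface. -/
def toFlat (p : Pt) : FlatPt :=
  ⟨(p.1 - (p.1 + p.2.1 + p.2.2) / 3, p.2.1 - (p.1 + p.2.1 + p.2.2) / 3,
      p.2.2 - (p.1 + p.2.1 + p.2.2) / 3), by
    dsimp only
    omega⟩

/-- `θ` solves the octahedron equation on the cube corner (at all unit cubes whose bottom vertex
`(x,y,z)` satisfies `x + y + z ≥ 0`), with initial data `t` on the flat surface. -/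
def IsCubeSolution {R : Type*} [CommRing R] (t : FlatPt → Rˣ) (θ : ℤ → ℤ → ℤ → R) : Prop :=
  (∀ p : FlatPt, θ p.1.1 p.1.2.1 p.1.2.2 = t p) ∧
  ∀ x y z : ℤ, 0 ≤ x + y + z →
    θ x y z * θ (x + 1) (y + 1) (z + 1) =
      θ (x + 1) y z * θ x (y + 1) (z + 1) + θ x (y + 1) z * θ (x + 1) y (z + 1)

/-- The `2 × 2` matrix `V(a,b,c)`, with first row `b/c, a/c` and second row `0, 1`. -/
def Vmat {R : Type*} [CommRing R] (a b c : Rˣ) : Matrix (Fin 2) (Fin 2) R :=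
  !![(b : R) * ((c⁻¹ : Rˣ) : R), (a : R) * ((c⁻¹ : Rˣ) : R); 0, 1]

/-- The embedding of a `2 × 2` matrix `A` into the `n × n` matrices: the identity matrix, except for
the block at the rows and columns labeled `i, i + 1`, which is `A`. Rows and columns are labeled
`1, …, n`, so that `r : Fin n` has the label `r + 1`. -/
def embedAt {R : Type*} [CommRing R] (n i : ℕ) (A : Matrix (Fin 2) (Fin 2) R) :
    Matrix (Fin n) (Fin n) R :=
  Matrix.of fun r s =>
    if (r : ℕ) + 1 = i ∧ (s : ℕ) + 1 = i then A 0 0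
    else if (r : ℕ) + 1 = i ∧ (s : ℕ) + 1 = i + 1 then A 0 1
    else if (r : ℕ) + 1 = i + 1 ∧ (s : ℕ) + 1 = i then A 1 0
    else if (r : ℕ) + 1 = i + 1 ∧ (s : ℕ) + 1 = i + 1 then A 1 1
    else if r = s then 1 else 0

/-- A `V`-type lozenge with its gray triangle on the bottom: `index` is the position of its matrix
in the embedding, and the other fields are the three vertices of the gray triangle (each vertex
stands for its projection onto the plane `(1,1,1)^⊥`). -/
structure Lozenge where
  index : ℕ
  bottom : Pt
  left : Pt
  right : Pt

/-- The matrix `V_i(u,v,w)` of a lozenge, whose arguments are the initial data at the bottom, left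
and right vertices of the gray triangle. -/
def Lozenge.matrix {R : Type*} [CommRing R] (t : FlatPt → Rˣ) (n : ℕ) (L : Lozenge) :
    Matrix (Fin n) (Fin n) R :=
  embedAt n L.index (Vmat (t (toFlat L.bottom)) (t (toFlat L.left)) (t (toFlat L.right)))

/-- The three lozenges of the hexagon (bottom half of a unit cube) around the bottom vertex `p`,
from left to right; their matrices multiply to `H_i = V_{i+1} V_i V_{i+1}`. The third coordinate
direction points up, the second one down left and the first one down right. -/
def hexagon (i : ℕ) (p : Pt) : List Lozenge :=
  [⟨i + 1, p + (0, 1, 0), p + (0, 1, 1), p⟩,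
   ⟨i, p + (1, 1, 0), p + (0, 1, 0), p + (1, 0, 0)⟩,
   ⟨i + 1, p + (1, 0, 0), p, p + (1, 0, 1)⟩]

/-- The bottom vertex of the unit cube number `s` (from the left, `0 ≤ s ≤ r`) of row number `r`
(from below, `0 ≤ r < N`) in the shadow of `(a,b,c)`, where `N = a + b + c - 2`. For these `r, s`
these are exactly the points `(x,y,z)` with `x + y + z = 0`, `x < a`, `y < b`, `z < c`. -/
def cubeBottom (N : ℕ) (a b c : ℤ) (r s : ℕ) : Pt :=
  (a - 1 - r + s, b - 1 - s, c - N + r)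

/-- The lozenge with index `2N + k` of the additional triangle above the shadow, in the strip number
`s` (`1 ≤ k ≤ s < N`). For `k = 1` it fills the notch between the top row hexagons number `s - 1`
and `s`; for `k > 1` it fills the notch between the lozenges `k - 1` of the strips `s - 1`, `s`. -/
def extraLozenge (N : ℕ) (a b c : ℤ) (k s : ℕ) : Lozenge :=
  ⟨2 * N + k, (a - N + s - k + 1, b - s, c), (a - N + s - k, b - s, c),
    (a - N + s - k + 1, b - s - 1, c)⟩

/-- The augmented shadow of `(a,b,c)`, where `N = a + b + c - 2`, as the list of its lozenges. It is
read from left to right in strips `s = 0, …, N - 1`, each strip from top to bottom: first the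
additional lozenges with indices `2N + s, …, 2N + 1`, then the hexagons with indices
`2N - 1, 2N - 3, …, 2s + 1`. -/
def augmentedShadow (N : ℕ) (a b c : ℤ) : List Lozenge :=
  (List.range N).flatMap fun s =>
    ((List.range s).map fun k => extraLozenge N a b c (s - k) s) ++
      (List.range (N - s)).flatMap fun m =>
        hexagon (2 * (N - 1 - m) + 1) (cubeBottom N a b c (N - 1 - m) s)

/-- The matrix of the augmented shadow: the ordered product of the matrices of its lozenges. -/
def shadowMatrix {R : Type*} [CommRing R] (t : FlatPt → Rˣ) (N : ℕ) (a b c : ℤ) :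
    Matrix (Fin (3 * N)) (Fin (3 * N)) R :=
  ((augmentedShadow N a b c).map (Lozenge.matrix t (3 * N))).prod

/-- The vertex number `i` (`1 ≤ i ≤ 3N + 1`, from bottom to top) of the West border of the augmented
shadow: one vertex on each level. -/
def westVertex (N : ℕ) (a b c : ℤ) (i : ℕ) : Pt :=
  if i ≤ 2 * N + 1 then
    (a - (i / 2 : ℕ), b, c - N + ((i - 1) / 2 : ℕ))
  else (a - N, b - ((i : ℤ) - (2 * N + 1)), c)

/-- The vertex number `i` (`1 ≤ i ≤ 3N + 1`, from bottom to top) of the East border of the augmented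
shadow: one vertex on each level. -/
def eastVertex (N : ℕ) (a b c : ℤ) (i : ℕ) : Pt :=
  if i ≤ 2 * N + 1 then
    (a, b - (i / 2 : ℕ), c - N + ((i - 1) / 2 : ℕ))
  else (a - ((i : ℤ) - (2 * N + 1)), b - N, c)

/-- The minor of a `3N × 3N` matrix with rows `N+1, …, 2N` and columns `2N+1, …, 3N` (with the
labels `1, …, 3N`). -/
def cornerMinor {R : Type*} [CommRing R] {N : ℕ} (M : Matrix (Fin (3 * N)) (Fin (3 * N)) R) : R :=
  (M.submatrix (fun k : Fin N => (⟨N + k, by omega⟩ : Fin (3 * N)))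
    (fun k : Fin N => (⟨2 * N + k, by omega⟩ : Fin (3 * N)))).det

/-- The right-hand side of the formula: the monomial prefactor in the border values, times the minor
of the matrix of the augmented shadow. -/
def shadowFormula {R : Type*} [CommRing R] (t : FlatPt → Rˣ) (N : ℕ) (a b c : ℤ) : R :=
  ((∏ i ∈ Finset.Icc (N + 2) (2 * N), (((t (toFlat (westVertex N a b c i)))⁻¹ : Rˣ) : R)) *
    ∏ j ∈ Finset.Icc (2 * N + 1) (3 * N), (t (toFlat (eastVertex N a b c j)) : R)) *
    cornerMinor (shadowMatrix t N a b c)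

/-- The field of rational functions over `ℚ` in one independent variable for each vertex of the flat
surface. -/
abbrev FormalField : Type := FractionRing (MvPolynomial FlatPt ℚ)

/-- The formal initial data: the independent variables themselves. -/
noncomputable def formalData (p : FlatPt) : FormalFieldˣ :=
  Units.mk0 (algebraMap (MvPolynomial FlatPt ℚ) FormalField (MvPolynomial.X p)) <|
    (map_ne_zero_iff _ (IsFractionRing.injective (MvPolynomial FlatPt ℚ) FormalField)).2
      (MvPolynomial.X_ne_zero p)

/-!
The proof is by a linear system that the octahedron equation makes consistent.

Orient a lozenge, a face of the cubic lattice, by its bottom, left, right and top vertices `b`, `l`,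
`r`, `t`, and let `w` be a unit-valued solution. A *flat section* attaches a vector `f` to every vertex in
such a way that `f l = f r + (w b * w t / (w l * w r)) • f t` for every lozenge. For `g = w • f`
this reads `g l = (w l / w r) • g r + (w b / w r) • g t`, which is exactly the action of the matrix
of the lozenge on two consecutive rows. Hence, if the rows of `G` are the values of `g` along a
border path, the matrix of the augmented shadow maps the matrix `G` of its East border to that of
its West border.

A flat section with values in `R ^ N` is built recursively from the apex `(a, b, c)` downwards
(`flatSection`): it vanishes on the plane `x = a`, and it is the standard basis on the upper part of
the East border. The relations of the faces in the plane `z = c` and of the faces parallel to the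
plane `y = 0` define it. The relations of the other faces follow by induction on the height
(`flatSection_face_left`, `flatSection_horizontal`), because the octahedron equation makes one face
coefficient the sum of two others, in two triples of faces of each unit cube.

Because of the values on the East border, the corner minor is, up to border values, the determinant
of the values of `f` on the middle part of the West border (`cornerMinor_mul_prod_east`). That
determinant is computed on the upper surface of the pile of cubes instead
(`det_flatSection_staircase`): a unitriangular change of rows moves it to the edge `y = b, z = c`,
and then bidiagonal matrices move it along the plane `z = c` to the standard basis, so that it is a
product of face coefficients over a rectangle. This product telescopes to the four corners of the
rectangle, one of which is the apex.

For nonzerodivisors one passes to the total ring of fractions. For formal initial data, a solution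
never vanishes since it is a quotient of polynomials which are positive at the point where all
variables are `1`, so that the recursion can be solved by division.
-/

/-! ### Flat sections of the octahedron equation -/

/-- The coefficient `b * t / (l * r)` of a face with bottom, left, right and top values `b`, `l`,
`r`, `t`. -/
def faceRatio {R : Type*} [CommRing R] (b l r t : Rˣ) : R := ((b * t * l⁻¹ * r⁻¹ : Rˣ) : R)

/-- The flat section on the plane `z = c` at the point `(a - j, b - (N - d), c)`, as a function of
`d` and `j`. On the line `y = b - N` (`d = 0`) it is the standard basis vector number `j`, with
labels `1, …, N` (so it is `0` for `j = 0` and for `j > N`). -/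
def topSection {R : Type*} [CommRing R] (w : ℕ → ℕ → ℕ → Rˣ) (N : ℕ) : ℕ → ℕ → Fin N → R
  | 0, j => fun i => if (i : ℕ) + 1 = j then 1 else 0
  | _ + 1, 0 => 0
  | d + 1, j + 1 => topSection w N d j +
      faceRatio (w j (N - (d + 1)) 0) (w (j + 1) (N - (d + 1)) 0) (w j (N - d) 0)
        (w (j + 1) (N - d) 0) • topSection w N d (j + 1)

/-- The flat section at the point `(a - j, b - k, c - m)`. On the plane `z = c` it is `topSection`,
on `x = a` it vanishes, and elsewhere it is propagated downwards by the relations of the faces that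
are parallel to the first and third coordinate directions. Only `k ≤ N` is meaningful, because of the
truncated subtraction. -/
def flatSection {R : Type*} [CommRing R] (w : ℕ → ℕ → ℕ → Rˣ) (N : ℕ) : ℕ → ℕ → ℕ → Fin N → R
  | j, k, 0 => topSection w N (N - k) j
  | 0, _, _ + 1 => 0
  | j + 1, k, m + 1 => flatSection w N j k m +
      faceRatio (w j k (m + 1)) (w (j + 1) k (m + 1)) (w j k m) (w (j + 1) k m) •
        flatSection w N (j + 1) k m

section Section
variable {R : Type*} [CommRing R] (w : ℕ → ℕ → ℕ → Rˣ) (N : ℕ)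

theorem topSection_zero_right (d : ℕ) : topSection w N d 0 = 0 := by
  cases d
  · funext i; simp [topSection]
  · rfl

theorem flatSection_zero_left (k m : ℕ) : flatSection w N 0 k m = 0 := by
  cases m
  · simp [flatSection, topSection_zero_right]
  · simp [flatSection]

theorem flatSection_succ_top (j k : ℕ) (hk : k < N) :
    flatSection w N (j + 1) k 0 = flatSection w N j (k + 1) 0 +
      faceRatio (w j k 0) (w (j + 1) k 0) (w j (k + 1) 0) (w (j + 1) (k + 1) 0) •
        flatSection w N (j + 1) (k + 1) 0 := by
  obtain ⟨d, rfl⟩ : ∃ d, N = k + 1 + d := ⟨N - (k + 1), by omega⟩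
  have h1 : k + 1 + d - k = d + 1 := by omega
  have h2 : k + 1 + d - (k + 1) = d := by omega
  have h3 : k + 1 + d - (d + 1) = k := by omega
  have h4 : k + 1 + d - d = k + 1 := by omega
  simp only [flatSection, h1, h2, topSection, h3, h4]

/-- The coefficients of the three faces of a cube containing `p + e₃` as their top vertex: the one
of the face containing `P` is the sum of those of the two faces containing `p`. Here `p` and `P`
are the values at the bottom and top vertices of the cube, and `p1, …, p23` are those at the vertices
`p + e₁, …, p + e₂ + e₃`. -/
theorem faceRatio_add_top {p1 p2 p3 p13 p23 p P : Rˣ}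
    (h : (p : R) * P = p1 * p23 + p2 * p13) :
    faceRatio P p23 p13 p3 = faceRatio p1 p p13 p3 + (faceRatio p2 p23 p p3 : R) := by
  have e : ∀ q : Rˣ, (q : R) * ((q⁻¹ : Rˣ) : R) = 1 := fun q => q.mul_inv
  refine (p * p23 * p13).isUnit.mul_left_cancel ?_
  simp only [faceRatio, Units.val_mul]
  calc _ = ((p : R) * P) * p3 * (p23 * (p23⁻¹ : Rˣ)) * (p13 * (p13⁻¹ : Rˣ)) := by ring
    _ = (p1 * p23 * p3) * (p * (p⁻¹ : Rˣ)) * (p13 * (p13⁻¹ : Rˣ)) +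
        (p2 * p13 * p3) * (p * (p⁻¹ : Rˣ)) * (p23 * (p23⁻¹ : Rˣ)) := by
      simp only [e, h]; ring
    _ = _ := by ring

/-- The coefficients of the three faces of a cube containing `p + e₁ + e₂` as their bottom vertex:
the one of the face containing `p` is the sum of those of the two faces containing `P`. -/
theorem faceRatio_add_bottom {p1 p2 p12 p13 p23 p P : Rˣ}
    (h : (p : R) * P = p1 * p23 + p2 * p13) :
    faceRatio p12 p2 p1 p = faceRatio p12 p2 P p23 + (faceRatio p12 P p1 p13 : R) := by
  have e : ∀ q : Rˣ, (q : R) * ((q⁻¹ : Rˣ) : R) = 1 := fun q => q.mul_inv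
  refine (P * p1 * p2).isUnit.mul_left_cancel ?_
  simp only [faceRatio, Units.val_mul]
  calc _ = ((p : R) * P) * p12 * (p1 * (p1⁻¹ : Rˣ)) * (p2 * (p2⁻¹ : Rˣ)) := by ring
    _ = (p1 * p23 * p12) * (P * (P⁻¹ : Rˣ)) * (p2 * (p2⁻¹ : Rˣ)) +
        (p2 * p13 * p12) * (P * (P⁻¹ : Rˣ)) * (p1 * (p1⁻¹ : Rˣ)) := by
      simp only [e, h]; ring
    _ = _ := by ring

/-- The remaining compatibility between the face coefficients of a cube; it holds for all values. -/
theorem faceRatio_mul_comm (p1 p2 p3 p12 p13 p23 p P : Rˣ) :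
    (faceRatio p12 p2 P p23 * faceRatio p2 p23 p p3 : R) =
      faceRatio p12 P p1 p13 * faceRatio p1 p p13 p3 := by
  have e : ∀ q : Rˣ, (q : R) * ((q⁻¹ : Rˣ) : R) = 1 := fun q => q.mul_inv
  simp only [faceRatio, Units.val_mul]
  calc _ = (p12 * p3 * (P⁻¹ : Rˣ) * (p⁻¹ : Rˣ) : R) * (p2 * (p2⁻¹ : Rˣ)) *
        (p23 * (p23⁻¹ : Rˣ)) := by ring
    _ = (p12 * p3 * (P⁻¹ : Rˣ) * (p⁻¹ : Rˣ) : R) * (p1 * (p1⁻¹ : Rˣ)) * (p13 * (p13⁻¹ : Rˣ)) := by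
        simp only [e]
    _ = _ := by ring

variable {w N}

/-- The octahedron equation for the values `w j k m` at the points `(a - j, b - k, c - m)`, at the
cubes of the pile below the apex `(a, b, c)`. As `a + b + c = N + 2`, the condition `j + k + m < N`
says that the bottom vertex of the cube satisfies `0 ≤ x + y + z`. -/
def IsOctahedral (w : ℕ → ℕ → ℕ → Rˣ) (N : ℕ) : Prop :=
  ∀ j k m, j + k + m < N → (w (j + 1) (k + 1) (m + 1) : R) * w j k m =
    w j (k + 1) (m + 1) * w (j + 1) k m + w (j + 1) k (m + 1) * w j (k + 1) m

/-- The relations of the faces parallel to the plane `x = 0` below height `c - m` follow from those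
of the horizontal faces at height `c - m`. -/
theorem flatSection_face_left_of_horizontal (hw : IsOctahedral w N) {m : ℕ}
    (H : ∀ j k, j + k + m < N → flatSection w N (j + 1) k m = flatSection w N j (k + 1) m +
      faceRatio (w j k m) (w (j + 1) k m) (w j (k + 1) m) (w (j + 1) (k + 1) m) •
        flatSection w N (j + 1) (k + 1) m) (j k : ℕ) (h : j + k + m < N + 1) :
    flatSection w N j k m = flatSection w N j (k + 1) (m + 1) +
      faceRatio (w j k (m + 1)) (w j k m) (w j (k + 1) (m + 1)) (w j (k + 1) m) •
        flatSection w N j (k + 1) m := by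
  cases j with
  | zero => simp [flatSection_zero_left]
  | succ j =>
    rw [H j k (by omega), flatSection, faceRatio_add_top (hw j k m (by omega)), add_smul,
      add_assoc]

/-- The relations of the horizontal faces. On the plane `z = c` they hold by definition, but only for
`k < N`; hence the smaller bound for `m = 0`. -/
theorem flatSection_horizontal (hw : IsOctahedral w N) (m : ℕ) :
    ∀ j k, j + k + m < N + min m 1 → flatSection w N (j + 1) k m = flatSection w N j (k + 1) m +
      faceRatio (w j k m) (w (j + 1) k m) (w j (k + 1) m) (w (j + 1) (k + 1) m) •
        flatSection w N (j + 1) (k + 1) m := by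
  induction m with
  | zero => intro j k h; exact flatSection_succ_top w N j k (by omega)
  | succ m ih =>
    intro j k h
    have H := flatSection_face_left_of_horizontal hw (m := m) (fun j k h => ih j k (by omega))
    have e1 := H (j + 1) k (by omega)
    have e2 := H j k (by omega)
    have e3 : flatSection w N (j + 1) (k + 1) (m + 1) = flatSection w N j (k + 1) m +
        faceRatio (w j (k + 1) (m + 1)) (w (j + 1) (k + 1) (m + 1)) (w j (k + 1) m)
          (w (j + 1) (k + 1) m) • flatSection w N (j + 1) (k + 1) m := by rw [flatSection]
    rw [flatSection, e1, e2, faceRatio_add_bottom (hw j k m (by omega))]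
    have hc := faceRatio_mul_comm (R := R) (w j (k + 1) (m + 1)) (w (j + 1) k (m + 1))
      (w (j + 1) (k + 1) m)
      (w j k (m + 1)) (w j (k + 1) m) (w (j + 1) k m) (w (j + 1) (k + 1) (m + 1)) (w j k m)
    funext i
    have e3i := congrFun e3 i
    simp only [Pi.add_apply, Pi.smul_apply, smul_eq_mul] at e3i ⊢
    linear_combination (flatSection w N (j + 1) (k + 1) m i) * hc -
      (faceRatio (w j k (m + 1)) (w j k m) (w j (k + 1) (m + 1)) (w j (k + 1) m)) * e3i

theorem flatSection_face_left (hw : IsOctahedral w N) (j k m : ℕ) (h : j + k + m < N + 1) :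
    flatSection w N j k m = flatSection w N j (k + 1) (m + 1) +
      faceRatio (w j k (m + 1)) (w j k m) (w j (k + 1) (m + 1)) (w j (k + 1) m) •
        flatSection w N j (k + 1) m :=
  flatSection_face_left_of_horizontal hw
    (fun j k h => flatSection_horizontal hw m j k (by omega)) j k h

end Section

section Section
variable {R : Type*} [CommRing R] {κ : Type*}

/-- The matrix whose row with label `i` is `φ (i + 1)`: a matrix of index `i` acts on a border path
by moving its vertex number `i + 1`, so that the vertex number `1` has no row. -/
def rowsOf (n : ℕ) (φ : ℕ → κ → R) : Matrix (Fin n) κ R := Matrix.of fun r => φ (r + 2)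

theorem embedAt_Vmat_mul_rowsOf {n i : ℕ} (hi : 1 ≤ i) (hin : i < n) (b l r : Rˣ)
    {φ φ' : ℕ → κ → R} (hne : ∀ v, v ≠ i + 1 → φ v = φ' v)
    (heq : φ (i + 1) = ((l * r⁻¹ : Rˣ) : R) • φ' (i + 1) + ((b * r⁻¹ : Rˣ) : R) • φ' (i + 2)) :
    embedAt n i (Vmat b l r) * rowsOf n φ' = rowsOf n φ := by
  ext x k
  rw [Matrix.mul_apply]
  by_cases hx : (x : ℕ) + 1 = i
  · have hxn : (x : ℕ) + 1 < n := by omega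
    have hne' : x ≠ ⟨x + 1, hxn⟩ := by simp [Fin.ext_iff]
    rw [Fintype.sum_eq_add x ⟨x + 1, hxn⟩ hne']
    · subst hx
      simp [embedAt, Vmat, rowsOf, heq]
    · intro y hy
      have h1 : (y : ℕ) ≠ x := fun h => hy.1 (Fin.ext h)
      have h2 : (y : ℕ) ≠ x + 1 := fun h => hy.2 (Fin.ext h)
      have : embedAt n i (Vmat b l r) x y = 0 := by
        simp only [embedAt, Matrix.of_apply]
        rw [if_neg (by omega), if_neg (by omega), if_neg (by omega), if_neg (by omega),
          if_neg (fun h => hy.1 h.symm)]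
      rw [this, zero_mul]
  · rw [Fintype.sum_eq_single x]
    · have : embedAt n i (Vmat b l r) x x = 1 := by
        simp [embedAt, Vmat, hx]
      rw [this, one_mul]
      simp only [rowsOf, Matrix.of_apply]
      rw [hne _ (by omega)]
    · intro y hy
      have h1 : (y : ℕ) ≠ x := fun h => hy (Fin.ext h)
      have : embedAt n i (Vmat b l r) x y = 0 := by
        simp only [embedAt, Matrix.of_apply]
        rw [if_neg (by omega), if_neg (by omega)]
        split_ifs <;> first | rfl | (exfalso; omega)
      rw [this, zero_mul]

/-- The action of a hexagon. The vector `y` belongs to its central vertex, which lies neither on the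
path before the hexagon nor on the path after it. -/
theorem hexagon_mul_rowsOf {n i : ℕ} (hi : 1 ≤ i) (hin : i + 1 < n)
    {b₁ l₁ r₁ b₂ l₂ r₂ b₃ l₃ r₃ : Rˣ} {φ φ' : ℕ → κ → R} (y : κ → R)
    (hne : ∀ v, v ≠ i + 1 → v ≠ i + 2 → φ v = φ' v)
    (h₁ : φ (i + 2) = ((l₁ * r₁⁻¹ : Rˣ) : R) • y + ((b₁ * r₁⁻¹ : Rˣ) : R) • φ' (i + 3))
    (h₂ : φ (i + 1) = ((l₂ * r₂⁻¹ : Rˣ) : R) • φ' (i + 1) + ((b₂ * r₂⁻¹ : Rˣ) : R) • y)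
    (h₃ : y = ((l₃ * r₃⁻¹ : Rˣ) : R) • φ' (i + 2) + ((b₃ * r₃⁻¹ : Rˣ) : R) • φ' (i + 3)) :
    embedAt n (i + 1) (Vmat b₁ l₁ r₁) * (embedAt n i (Vmat b₂ l₂ r₂) *
      (embedAt n (i + 1) (Vmat b₃ l₃ r₃) * rowsOf n φ')) = rowsOf n φ := by
  -- the path passes through the centre of the hexagon after the first factor to be applied, and
  -- moves its vertex `i + 1` before leaving the centre again
  rw [embedAt_Vmat_mul_rowsOf (φ := Function.update φ' (i + 2) y) (by omega) (by omega),
    embedAt_Vmat_mul_rowsOf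
      (φ := Function.update (Function.update φ' (i + 2) y) (i + 1) (φ (i + 1))) (by omega)
      (by omega),
    embedAt_Vmat_mul_rowsOf (φ := φ) (by omega) (by omega)]
  · intro v hv
    by_cases h : v = i + 1
    · simp [h]
    · simp [Function.update_of_ne, h, hne v h hv, show v ≠ i + 2 from hv]
  · simpa using h₁
  · intro v hv
    simp [hv]
  · simpa using h₂
  · intro v hv
    simp [show v ≠ i + 2 from hv]
  · simpa using h₃

end Section

/-! ### Sweeping the shadow with border paths -/

/-- The vertex number `v` of the border path to the left of the strip number `s` of the augmented
shadow, where `(j, k, m)` stands for the point `(a - j, b - k, c - m)`. For `s = 0` this is the West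
border, and for `s = N` the East border. -/
def stripVertex (N s v : ℕ) : ℕ × ℕ × ℕ :=
  if v ≤ 2 * s + 1 then (0, v / 2, N - (v - 1) / 2)
  else if v ≤ 2 * N + 1 then (v / 2 - s, s, N - (v - 1) / 2)
  else if v ≤ 2 * N + 1 + s then (v - (N + 1 + s), s, 0)
  else (N, v - (2 * N + 1), 0)

section
variable {R : Type*} [CommRing R] (w : ℕ → ℕ → ℕ → Rˣ) (N : ℕ)

/-- The flat section times the value `w` at a point. -/
def vertexVector (q : ℕ × ℕ × ℕ) : Fin N → R :=
  (w q.1 q.2.1 q.2.2 : R) • flatSection w N q.1 q.2.1 q.2.2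

/-- The vectors `vertexVector` along a path through the strip number `s`: it follows the left border
of the strip up to the vertex number `h`, and the right border above. The lozenges of the strip are
read from top to bottom, so that `h` decreases as they are passed. -/
def cutRows (s h v : ℕ) : Fin N → R :=
  vertexVector w N (stripVertex N (if v ≤ h then s else s + 1) v)

/-- The relation of a face, in the form in which the matrix of a lozenge acts. -/
theorem vertexVector_face {b l r t : ℕ × ℕ × ℕ}
    (h : flatSection w N l.1 l.2.1 l.2.2 = flatSection w N r.1 r.2.1 r.2.2 +
      faceRatio (w b.1 b.2.1 b.2.2) (w l.1 l.2.1 l.2.2) (w r.1 r.2.1 r.2.2) (w t.1 t.2.1 t.2.2) •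
        flatSection w N t.1 t.2.1 t.2.2) :
    vertexVector w N l =
      ((w l.1 l.2.1 l.2.2 * (w r.1 r.2.1 r.2.2)⁻¹ : Rˣ) : R) • vertexVector w N r +
      ((w b.1 b.2.1 b.2.2 * (w r.1 r.2.1 r.2.2)⁻¹ : Rˣ) : R) • vertexVector w N t := by
  simp only [vertexVector]
  rw [h]
  simp only [smul_add, smul_smul, faceRatio, ← Units.val_mul]
  generalize w b.1 b.2.1 b.2.2 = wb, w l.1 l.2.1 l.2.2 = wl, w r.1 r.2.1 r.2.2 = wr,
    w t.1 t.2.1 t.2.2 = wt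
  have h₁ : wl * wr⁻¹ * wr = wl := inv_mul_cancel_right wl wr
  have h₂ : wl * (wb * wt * wl⁻¹ * wr⁻¹) = wb * wr⁻¹ * wt :=
    calc _ = (wl * wl⁻¹) * (wb * wr⁻¹ * wt) := by ac_rfl
      _ = _ := by rw [mul_inv_cancel, one_mul]
  rw [h₁, h₂]

theorem cutRows_top_eq {s : ℕ} (hs : s < N) (v : ℕ) :
    cutRows w N s (2 * N + s + 1) v =
      vertexVector w N (stripVertex N s v) := by
  unfold cutRows
  split_ifs with h
  · rfl
  · congr 1
    simp only [stripVertex]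
    split_ifs <;> simp only [Prod.mk.injEq, and_true] <;> omega

theorem cutRows_bottom_eq (s : ℕ) (v : ℕ) :
    cutRows w N s (2 * s + 1) v =
      vertexVector w N (stripVertex N (s + 1) v) := by
  unfold cutRows
  split_ifs with h
  · congr 1
    simp only [stripVertex]
    split_ifs <;> simp only [Prod.mk.injEq, and_true] <;> omega
  · rfl

theorem extra_mul_cutRows {k s : ℕ} (hk : 1 ≤ k) (hks : k ≤ s) (hs : s < N) :
    embedAt (3 * N) (2 * N + k) (Vmat (w (N - s + k - 1) s 0) (w (N - s + k) s 0)
      (w (N - s + k - 1) (s + 1) 0)) * rowsOf (3 * N) (cutRows w N s (2 * N + k)) =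
      rowsOf (3 * N) (cutRows w N s (2 * N + k + 1)) := by
  obtain ⟨j, hj⟩ : ∃ j, N - s + k = j + 1 := ⟨N - s + k - 1, by omega⟩
  simp only [hj, Nat.add_sub_cancel]
  apply embedAt_Vmat_mul_rowsOf (by omega) (by omega)
  · intro v hv
    simp only [cutRows]
    congr 2
    split_ifs <;> omega
  · have h1 : cutRows w N s (2 * N + k + 1) (2 * N + k + 1) = vertexVector w N (j + 1, s, 0) := by
      rw [cutRows, if_pos (by omega)]
      congr 1
      simp only [stripVertex]
      split_ifs <;> simp only [Prod.mk.injEq, true_and, and_true] <;> omega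
    have h2 : cutRows w N s (2 * N + k) (2 * N + k + 1) = vertexVector w N (j, s + 1, 0) := by
      rw [cutRows, if_neg (by omega)]
      congr 1
      simp only [stripVertex]
      split_ifs <;> simp only [Prod.mk.injEq, true_and, and_true] <;> omega
    have h3 : cutRows w N s (2 * N + k) (2 * N + k + 2) = vertexVector w N (j + 1, s + 1, 0) := by
      rw [cutRows, if_neg (by omega)]
      congr 1
      simp only [stripVertex]
      split_ifs <;> simp only [Prod.mk.injEq, true_and, and_true] <;> omega
    rw [h1, h2, h3]
    exact vertexVector_face w N (b := (j, s, 0)) (l := (j + 1, s, 0)) (r := (j, s + 1, 0))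
      (t := (j + 1, s + 1, 0)) (flatSection_succ_top w N j s hs)

variable {w N} in
/-- The hexagon around `(a - (j + 1), b - (s + 1), c - (m + 1))` moves the cut of strip `s` by two
vertices. -/
theorem hexagon_mul_cutRows (hw : IsOctahedral w N) {j s m : ℕ} (h : j + s + m + 1 = N) :
    embedAt (3 * N) (2 * (s + j) + 1 + 1)
        (Vmat (w (j + 1) s (m + 1)) (w (j + 1) s m) (w (j + 1) (s + 1) (m + 1))) *
      (embedAt (3 * N) (2 * (s + j) + 1)
        (Vmat (w j s (m + 1)) (w (j + 1) s (m + 1)) (w j (s + 1) (m + 1))) *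
      (embedAt (3 * N) (2 * (s + j) + 1 + 1)
        (Vmat (w j (s + 1) (m + 1)) (w (j + 1) (s + 1) (m + 1)) (w j (s + 1) m)) *
      rowsOf (3 * N) (cutRows w N s (2 * (s + j) + 1)))) =
      rowsOf (3 * N) (cutRows w N s (2 * (s + j) + 3)) := by
  have g1 : cutRows w N s (2 * (s + j) + 3) (2 * (s + j) + 1 + 2) =
      vertexVector w N (j + 1, s, m) := by
    rw [cutRows, if_pos (by omega)]
    congr 1
    simp only [stripVertex]
    split_ifs <;> simp only [Prod.mk.injEq, true_and] <;> omega
  have g2 : cutRows w N s (2 * (s + j) + 3) (2 * (s + j) + 1 + 1) =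
      vertexVector w N (j + 1, s, m + 1) := by
    rw [cutRows, if_pos (by omega)]
    congr 1
    simp only [stripVertex]
    split_ifs <;> simp only [Prod.mk.injEq, true_and] <;> omega
  have g3 : cutRows w N s (2 * (s + j) + 1) (2 * (s + j) + 1 + 1) =
      vertexVector w N (j, s + 1, m + 1) := by
    rw [cutRows, if_neg (by omega)]
    congr 1
    simp only [stripVertex]
    split_ifs <;> simp only [Prod.mk.injEq, true_and] <;> omega
  have g4 : cutRows w N s (2 * (s + j) + 1) (2 * (s + j) + 1 + 2) =
      vertexVector w N (j, s + 1, m) := by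
    rw [cutRows, if_neg (by omega)]
    congr 1
    simp only [stripVertex]
    split_ifs <;> simp only [Prod.mk.injEq, true_and] <;> omega
  have g5 : cutRows w N s (2 * (s + j) + 1) (2 * (s + j) + 1 + 3) =
      vertexVector w N (j + 1, s + 1, m) := by
    rw [cutRows, if_neg (by omega)]
    congr 1
    simp only [stripVertex]
    split_ifs <;> simp only [Prod.mk.injEq, true_and] <;> omega
  refine hexagon_mul_rowsOf (by omega) (by omega) (vertexVector w N (j + 1, s + 1, m + 1))
    ?_ ?_ ?_ ?_
  · intro v h1 h2
    simp only [cutRows]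
    congr 2
    split_ifs <;> omega
  · rw [g1, g5]
    exact vertexVector_face w N (b := (j + 1, s, m + 1)) (l := (j + 1, s, m))
      (r := (j + 1, s + 1, m + 1)) (t := (j + 1, s + 1, m))
      (flatSection_face_left hw (j + 1) s m (by omega))
  · rw [g2, g3]
    exact vertexVector_face w N (b := (j, s, m + 1)) (l := (j + 1, s, m + 1))
      (r := (j, s + 1, m + 1)) (t := (j + 1, s + 1, m + 1))
      (flatSection_horizontal hw (m + 1) j s (by omega))
  · rw [g4, g5]
    exact vertexVector_face w N (b := (j, s + 1, m + 1)) (l := (j + 1, s + 1, m + 1))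
      (r := (j, s + 1, m)) (t := (j + 1, s + 1, m)) (by simp only [flatSection])

end

/-! ### The determinant on the upper surface -/

section
variable {R : Type*} [CommRing R]

theorem faceRatio_self (b l : Rˣ) : (faceRatio b l b l : R) = 1 := by
  rw [faceRatio, ← Units.val_one]
  congr 1
  calc _ = (b * b⁻¹) * (l * l⁻¹) := by ac_rfl
    _ = _ := by simp

theorem faceRatio_mul_faceRatio_left (b l r t l' t' : Rˣ) :
    (faceRatio b l r t * faceRatio l l' t t' : R) = faceRatio b l' r t' := by
  simp only [faceRatio, ← Units.val_mul]
  congr 1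
  calc _ = (l * l⁻¹) * (t * t⁻¹) * (b * t' * l'⁻¹ * r⁻¹) := by ac_rfl
    _ = _ := by simp

theorem faceRatio_mul_faceRatio_right (b l r t r' t' : Rˣ) :
    (faceRatio b l r t * faceRatio r t r' t' : R) = faceRatio b l r' t' := by
  simp only [faceRatio, ← Units.val_mul]
  congr 1
  calc _ = (r * r⁻¹) * (t * t⁻¹) * (b * t' * l⁻¹ * r'⁻¹) := by ac_rfl
    _ = _ := by simp

theorem prod_faceRatio (x y : ℕ → Rˣ) (n : ℕ) :
    ∏ i ∈ Finset.range n, (faceRatio (x i) (x (i + 1)) (y i) (y (i + 1)) : R) =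
      faceRatio (x 0) (x n) (y 0) (y n) := by
  induction n with
  | zero =>
    rw [Finset.prod_range_zero, faceRatio, ← Units.val_one]
    congr 1
    calc _ = (x 0 * (x 0)⁻¹) * (y 0 * (y 0)⁻¹) := by simp
      _ = _ := by ac_rfl
  | succ n ih => rw [Finset.prod_range_succ, ih, faceRatio_mul_faceRatio_left]

variable (w : ℕ → ℕ → ℕ → Rˣ) (N : ℕ)

/-- The determinant of the flat section on the segment `y = b - (N - d)`, `z = c`, by induction on
`d`: the segments `d` and `d + 1` differ by a bidiagonal matrix, whose diagonal has a telescoping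
product. -/
theorem det_topSection (d : ℕ) (hd : d ≤ N) :
    (Matrix.of fun i : Fin N => topSection w N d (i + 1)).det =
      faceRatio (w 0 (N - d) 0) (w N (N - d) 0) (w 0 N 0) (w N N 0) := by
  induction d with
  | zero =>
    have : (Matrix.of fun i : Fin N => topSection w N 0 (i + 1)) = 1 := by
      ext i j
      simp [topSection, Matrix.one_apply, Fin.ext_iff, eq_comm]
    rw [this, Matrix.det_one, Nat.sub_zero, faceRatio_self]
  | succ d ih =>
    let x : ℕ → R := fun i => faceRatio (w i (N - (d + 1)) 0) (w (i + 1) (N - (d + 1)) 0)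
      (w i (N - d) 0) (w (i + 1) (N - d) 0)
    let C : Matrix (Fin N) (Fin N) R := Matrix.of fun i j =>
      if j = i then x i else if (j : ℕ) + 1 = i then 1 else 0
    have hC : (Matrix.of fun i : Fin N => topSection w N (d + 1) (i + 1)) =
        C * Matrix.of fun i : Fin N => topSection w N d (i + 1) := by
      ext i k
      rw [Matrix.mul_apply]
      simp only [Matrix.of_apply, topSection, Pi.add_apply, Pi.smul_apply, smul_eq_mul, C]
      -- the first row has one entry only, as the section vanishes at `j = 0`
      obtain ⟨_ | i, hi⟩ := i
      · rw [Fintype.sum_eq_single ⟨0, hi⟩]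
        · simp [topSection_zero_right, x]
        · intro j hj
          simp [hj]
      · rw [Fintype.sum_eq_add (⟨i, by omega⟩ : Fin N) ⟨i + 1, hi⟩ (by simp)]
        · simp [x]
        · rintro j ⟨h1, h2⟩
          rw [if_neg h2, if_neg, zero_mul]
          intro h
          exact h1 (Fin.ext (Nat.succ_injective h))
    -- along the segment the diagonal of `C` telescopes
    have hdet : C.det = faceRatio (w 0 (N - (d + 1)) 0) (w N (N - (d + 1)) 0)
        (w 0 (N - d) 0) (w N (N - d) 0) := by
      rw [Matrix.det_of_isLowerTriangular]
      · simp only [C, Matrix.of_apply, if_true]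
        rw [Fin.prod_univ_eq_prod_range x N]
        exact prod_faceRatio (fun i => w i (N - (d + 1)) 0) (fun i => w i (N - d) 0) N
      · intro i j hij
        have hij' : (i : ℕ) < j := hij
        simp only [C, Matrix.of_apply]
        rw [if_neg (fun h => by omega), if_neg (by omega)]
    rw [hC, Matrix.det_mul, hdet, ih (by omega), faceRatio_mul_faceRatio_right]

/-- The section at `(a - j, b - k, c - m)` is a combination of the vectors at the points `(a - (i +
1), b - k, c)`, where the first label `i + 1` that occurs is `j - m`, with coefficient `1`. -/
theorem exists_flatSection_eq_sum (k m j : ℕ) (hj : j ≤ N) (hm : m < j) :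
    ∃ q : Fin N → R, (∀ i : Fin N, (i : ℕ) + 1 < j - m → q i = 0) ∧
      (∀ i : Fin N, (i : ℕ) + 1 = j - m → q i = 1) ∧
      flatSection w N j k m = ∑ i, q i • flatSection w N (i + 1) k 0 := by
  induction m generalizing j with
  | zero =>
    refine ⟨fun i => if (i : ℕ) + 1 = j then 1 else 0, fun i hi => if_neg (by omega),
      fun i hi => if_pos (by omega), ?_⟩
    rw [Fintype.sum_eq_single ⟨j - 1, by omega⟩]
    · simp [show j - 1 + 1 = j by omega]
    · intro i hi
      simp only
      rw [if_neg, zero_smul]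
      intro h
      exact hi (Fin.ext (Nat.eq_sub_of_add_eq h))
  | succ m ih =>
    obtain ⟨j, rfl⟩ : ∃ l, j = l + 1 := ⟨j - 1, by omega⟩
    obtain ⟨q, h0, h1, hq⟩ := ih j (by omega) (by omega)
    obtain ⟨q', h0', h1', hq'⟩ := ih (j + 1) (by omega) (by omega)
    rw [flatSection, hq, hq']
    generalize faceRatio (w j k (m + 1)) (w (j + 1) k (m + 1)) (w j k m) (w (j + 1) k m) = x
    refine ⟨q + x • q', fun i hi => ?_, fun i hi => ?_, ?_⟩
    · simp [h0 i (by omega), h0' i (by omega)]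
    · simp [h1 i (by omega), h0' i (by omega)]
    · simp [add_smul, Finset.sum_add_distrib, Finset.smul_sum, smul_smul]

/-- The determinant of the flat section along the vertices `N + 2, …, 2N + 1` of the West border. -/
theorem det_flatSection_staircase :
    (Matrix.of fun i : Fin N =>
      flatSection w N ((N + 2 + i) / 2) 0 (N - (N + 2 + i - 1) / 2)).det =
      faceRatio (w 0 0 0) (w N 0 0) (w 0 N 0) (w N N 0) := by
  choose q h0 h1 hq using fun i : Fin N => exists_flatSection_eq_sum w N 0
    (N - (N + 2 + i - 1) / 2) ((N + 2 + i) / 2) (by omega) (by omega)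
  have hmul : (Matrix.of fun i : Fin N =>
      flatSection w N ((N + 2 + i) / 2) 0 (N - (N + 2 + i - 1) / 2)) =
      Matrix.of q * Matrix.of fun i : Fin N => topSection w N N (i + 1) := by
    ext i l
    rw [Matrix.mul_apply, Matrix.of_apply, hq i]
    simp [Finset.sum_apply, flatSection]
  have hdet : (Matrix.of q).det = 1 := by
    rw [Matrix.det_of_isUpperTriangular]
    · exact Finset.prod_eq_one fun i _ => h1 i i (by omega)
    · intro i j hij
      have hij' : (j : ℕ) < i := hij
      exact h0 i j (by omega)
  rw [hmul, Matrix.det_mul, hdet, one_mul, det_topSection w N N le_rfl, Nat.sub_self]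

end

/-! ### The matrix of the augmented shadow -/

section
variable {R : Type*} [CommRing R]

/-- The values of `u` in the coordinates that count downwards from the apex `(a, b, c)`. -/
def apexData (u : Pt → Rˣ) (a b c : ℤ) (j k m : ℕ) : Rˣ := u (a - j, b - k, c - m)

theorem isOctahedral_apexData {u : Pt → Rˣ} (hu : ∀ x y z : ℤ, 0 ≤ x + y + z →
      (u (x, y, z) : R) * u (x + 1, y + 1, z + 1) =
        u (x + 1, y, z) * u (x, y + 1, z + 1) + u (x, y + 1, z) * u (x + 1, y, z + 1))
    {N : ℕ} {a b c : ℤ} (habc : a + b + c = N + 2) : IsOctahedral (apexData u a b c) N := by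
  intro j k m h
  have e : ∀ (x : ℤ) (i : ℕ), x - ((i + 1 : ℕ) : ℤ) + 1 = x - i := fun x i => by
    push_cast; ring
  have := hu (a - (j + 1 : ℕ)) (b - (k + 1 : ℕ)) (c - (m + 1 : ℕ)) (by omega)
  simp only [e] at this
  exact this

variable {t : FlatPt → Rˣ} {u : Pt → Rˣ}
  (hflat : ∀ p : Pt, p.1 + p.2.1 + p.2.2 ≤ 2 → u p = t (toFlat p))
  {N : ℕ} {a b c : ℤ} (habc : a + b + c = N + 2)

include hflat habc

theorem apply_toFlat_eq_apexData {p : Pt} {j k m : ℕ} (h₁ : p.1 = a - j) (h₂ : p.2.1 = b - k)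
    (h₃ : p.2.2 = c - m) (h : N ≤ j + k + m) : t (toFlat p) = apexData u a b c j k m := by
  obtain ⟨x, y, z⟩ := p
  dsimp only at h₁ h₂ h₃
  subst h₁ h₂ h₃
  exact (hflat _ (by dsimp only; omega)).symm

theorem extraLozenge_matrix_eq {k s : ℕ} (hk : 1 ≤ k) (hs : s < N) :
    (extraLozenge N a b c k s).matrix t (3 * N) = embedAt (3 * N) (2 * N + k)
      (Vmat (apexData u a b c (N - s + k - 1) s 0) (apexData u a b c (N - s + k) s 0)
        (apexData u a b c (N - s + k - 1) (s + 1) 0)) := by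
  simp only [Lozenge.matrix, extraLozenge]
  congr 2 <;> apply apply_toFlat_eq_apexData hflat habc <;> first | (dsimp only <;> omega) | omega

theorem hexagon_matrix_eq {j s m : ℕ} (h : j + s + m + 1 = N) (i : ℕ) :
    (hexagon i (cubeBottom N a b c (s + j) s)).map (Lozenge.matrix t (3 * N)) =
      [embedAt (3 * N) (i + 1) (Vmat (apexData u a b c (j + 1) s (m + 1))
          (apexData u a b c (j + 1) s m) (apexData u a b c (j + 1) (s + 1) (m + 1))),
        embedAt (3 * N) i (Vmat (apexData u a b c j s (m + 1))
          (apexData u a b c (j + 1) s (m + 1)) (apexData u a b c j (s + 1) (m + 1))),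
        embedAt (3 * N) (i + 1) (Vmat (apexData u a b c j (s + 1) (m + 1))
          (apexData u a b c (j + 1) (s + 1) (m + 1)) (apexData u a b c j (s + 1) m))] := by
  simp only [Lozenge.matrix, hexagon, cubeBottom, List.map_cons, List.map_nil, Prod.mk_add_mk]
  congr <;> apply apply_toFlat_eq_apexData hflat habc <;> first | (dsimp only <;> omega) | omega

theorem extraLozenges_mul_cutRows {s n : ℕ} (hs : s < N) (hn : n ≤ s) :
    (((List.range n).map fun k => extraLozenge N a b c (s - k) s).map
      (Lozenge.matrix t (3 * N))).prod *
        rowsOf (3 * N) (cutRows (apexData u a b c) N s (2 * N + s + 1 - n)) =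
      rowsOf (3 * N) (cutRows (apexData u a b c) N s (2 * N + s + 1)) := by
  induction n with
  | zero => simp
  | succ n ih =>
    rw [← ih (by omega)]
    simp only [List.range_succ, List.map_append, List.prod_append, List.map_cons, List.map_nil,
      List.prod_singleton]
    rw [Matrix.mul_assoc, extraLozenge_matrix_eq hflat habc (by omega) hs]
    have := extra_mul_cutRows (apexData u a b c) N (k := s - n) (s := s) (by omega) (by omega) hs
    rw [show 2 * N + s + 1 - (n + 1) = 2 * N + (s - n) by omega,
      show 2 * N + s + 1 - n = 2 * N + (s - n) + 1 by omega, this]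

theorem hexagons_mul_cutRows (hw : IsOctahedral (apexData u a b c) N) {s n : ℕ}
    (hn : s + n ≤ N) :
    (((List.range n).flatMap fun m =>
        hexagon (2 * (N - 1 - m) + 1) (cubeBottom N a b c (N - 1 - m) s)).map
      (Lozenge.matrix t (3 * N))).prod *
        rowsOf (3 * N) (cutRows (apexData u a b c) N s (2 * N + 1 - 2 * n)) =
      rowsOf (3 * N) (cutRows (apexData u a b c) N s (2 * N + 1)) := by
  induction n with
  | zero => simp
  | succ n ih =>
    rw [← ih (by omega)]
    obtain ⟨j, hj⟩ : ∃ j, j + s + n + 1 = N := ⟨N - 1 - s - n, by omega⟩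
    simp only [List.range_succ, List.flatMap_append, List.map_append, List.prod_append,
      List.flatMap_cons, List.flatMap_nil, List.append_nil]
    have hr : N - 1 - n = s + j := by omega
    have := hexagon_mul_cutRows hw hj
    rw [hr, hexagon_matrix_eq hflat habc hj, Matrix.mul_assoc,
      show 2 * N + 1 - 2 * (n + 1) = 2 * (s + j) + 1 by omega,
      show 2 * N + 1 - 2 * n = 2 * (s + j) + 3 by omega, ← this]
    simp only [List.prod_cons, List.prod_nil, mul_one, Matrix.mul_assoc]

/-- The first `n` strips of the augmented shadow map the rows of the border path number `n` to those
of the West border. -/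
theorem shadow_mul_rowsOf (hw : IsOctahedral (apexData u a b c) N) {n : ℕ} (hn : n ≤ N) :
    (((List.range n).flatMap fun s =>
      ((List.range s).map fun k => extraLozenge N a b c (s - k) s) ++
        (List.range (N - s)).flatMap fun m =>
          hexagon (2 * (N - 1 - m) + 1) (cubeBottom N a b c (N - 1 - m) s)).map
      (Lozenge.matrix t (3 * N))).prod *
        rowsOf (3 * N) (fun v => vertexVector (apexData u a b c) N (stripVertex N n v)) =
      rowsOf (3 * N) (fun v => vertexVector (apexData u a b c) N (stripVertex N 0 v)) := by
  induction n with
  | zero => simp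
  | succ n ih =>
    rw [← ih (by omega)]
    have hE := extraLozenges_mul_cutRows hflat habc (s := n) (n := n) (by omega) le_rfl
    have hH := hexagons_mul_cutRows hflat habc hw (s := n) (n := N - n) (by omega)
    rw [show 2 * N + n + 1 - n = 2 * N + 1 by omega,
      funext (cutRows_top_eq (apexData u a b c) N (s := n) (by omega))] at hE
    rw [show 2 * N + 1 - 2 * (N - n) = 2 * n + 1 by omega,
      funext (cutRows_bottom_eq (apexData u a b c) N n)] at hH
    rw [List.range_succ, List.flatMap_append, List.map_append, List.prod_append, Matrix.mul_assoc]
    simp only [List.flatMap_cons, List.flatMap_nil, List.append_nil, List.map_append,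
      List.prod_append] at hE hH ⊢
    rw [Matrix.mul_assoc, hH, hE]

theorem apply_westVertex {i : ℕ} (hi : 1 ≤ i) : t (toFlat (westVertex N a b c i)) =
    apexData u a b c (stripVertex N 0 i).1 (stripVertex N 0 i).2.1 (stripVertex N 0 i).2.2 := by
  apply apply_toFlat_eq_apexData hflat habc <;> simp only [westVertex, stripVertex] <;>
    split_ifs <;> first | omega | (dsimp only; omega)

theorem apply_eastVertex {i : ℕ} (hi : 1 ≤ i) (hi' : i ≤ 3 * N + 1) :
    t (toFlat (eastVertex N a b c i)) =
    apexData u a b c (stripVertex N N i).1 (stripVertex N N i).2.1 (stripVertex N N i).2.2 := by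
  apply apply_toFlat_eq_apexData hflat habc <;> simp only [eastVertex, stripVertex] <;>
    split_ifs <;> first | omega | (dsimp only <;> omega)

end

/-! ### The corner minor -/

section
variable {R : Type*} [CommRing R]

theorem stripVertex_east_le {N v : ℕ} (h : v ≤ 2 * N + 1) :
    stripVertex N N v = (0, v / 2, N - (v - 1) / 2) := by
  rw [stripVertex, if_pos h]

theorem stripVertex_east_gt {N v : ℕ} (h : 2 * N + 1 < v) (h' : v ≤ 3 * N + 1) :
    stripVertex N N v = (v - (2 * N + 1), N, 0) := by
  rw [stripVertex, if_neg (by omega), if_neg (by omega), if_pos (by omega)]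
  congr 1
  omega

theorem stripVertex_west_le {N v : ℕ} (h : 2 ≤ v) (h' : v ≤ 2 * N + 1) :
    stripVertex N 0 v = (v / 2, 0, N - (v - 1) / 2) := by
  rw [stripVertex, if_neg (by omega), if_pos h', Nat.sub_zero]

/-- The value of `w` at a point. -/
def vertexValue (w : ℕ → ℕ → ℕ → Rˣ) (q : ℕ × ℕ × ℕ) : Rˣ := w q.1 q.2.1 q.2.2

/-- On the East border the vectors with labels `1, …, 2N` vanish and the remaining ones are
multiples of the standard basis, so that multiplication by them selects the last `N` columns of `M`.
-/
theorem cornerMinor_mul_prod_east (w : ℕ → ℕ → ℕ → Rˣ) {N : ℕ}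
    (M : Matrix (Fin (3 * N)) (Fin (3 * N)) R)
    (hM : M * rowsOf (3 * N) (fun v => vertexVector w N (stripVertex N N v)) =
      rowsOf (3 * N) (fun v => vertexVector w N (stripVertex N 0 v))) :
    cornerMinor M * ∏ j ∈ Finset.range N, (vertexValue w (stripVertex N N (2 * N + 2 + j)) : R) =
      (∏ i ∈ Finset.range N, (vertexValue w (stripVertex N 0 (N + 2 + i)) : R)) *
        faceRatio (w 0 0 0) (w N 0 0) (w 0 N 0) (w N N 0) := by
  have key : M.submatrix (fun k : Fin N => (⟨N + k, by omega⟩ : Fin (3 * N)))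
      (fun k : Fin N => (⟨2 * N + k, by omega⟩ : Fin (3 * N))) *
        Matrix.diagonal (fun j : Fin N =>
          (vertexValue w (stripVertex N N (2 * N + 2 + j)) : R)) =
      Matrix.diagonal (fun i : Fin N =>
          (vertexValue w (stripVertex N 0 (N + 2 + i)) : R)) *
        Matrix.of fun i : Fin N =>
          flatSection w N ((N + 2 + i) / 2) 0 (N - (N + 2 + i - 1) / 2) := by
    ext i j
    have h := congrFun (congrFun hM ⟨N + i, by omega⟩) j
    rw [Matrix.mul_apply, Fintype.sum_eq_single ⟨2 * N + j, by omega⟩] at h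
    · rw [Matrix.mul_diagonal, Matrix.diagonal_mul, Matrix.submatrix_apply]
      simp only [rowsOf, Matrix.of_apply, vertexVector] at h ⊢
      rw [show 2 * N + (j : ℕ) + 2 = 2 * N + 2 + j by omega,
        show N + (i : ℕ) + 2 = N + 2 + i by omega] at h
      convert h using 1
      · rw [stripVertex_east_gt (by omega) (by omega)]
        simp [vertexValue, flatSection, topSection,
          show 2 * N + 2 + (j : ℕ) - (2 * N + 1) = j + 1 by omega]
      · rw [stripVertex_west_le (by omega) (by omega)]
        simp [vertexValue]
    · intro y hy
      have hy' : (y : ℕ) ≠ 2 * N + j := fun h => hy (Fin.ext h)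
      have hz : rowsOf (3 * N) (fun v => vertexVector w N (stripVertex N N v)) y j = 0 := by
        simp only [rowsOf, Matrix.of_apply, vertexVector]
        by_cases hyN : (y : ℕ) + 2 ≤ 2 * N + 1
        · simp [stripVertex_east_le hyN, flatSection_zero_left]
        · rw [stripVertex_east_gt (by omega) (by omega)]
          have : (j : ℕ) + 1 ≠ y + 2 - (2 * N + 1) := by omega
          simp only [flatSection, Nat.sub_self, topSection, Pi.smul_apply, if_neg this, smul_zero]
      rw [hz, mul_zero]
  have hdet := congrArg Matrix.det key
  rw [Matrix.det_mul, Matrix.det_mul, Matrix.det_diagonal, Matrix.det_diagonal,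
    det_flatSection_staircase,
    Fin.prod_univ_eq_prod_range (fun j =>
      (vertexValue w (stripVertex N N (2 * N + 2 + j)) : R)),
    Fin.prod_univ_eq_prod_range (fun i => (vertexValue w (stripVertex N 0 (N + 2 + i)) : R))]
    at hdet
  exact hdet

/-- The formula for unit-valued solutions `u`. On the negative levels, which occur only as vertices
of the additional lozenges, `u` is the periodic extension of the initial data and need not satisfy
the octahedron equation. -/
theorem shadowFormula_eq_apex {t : FlatPt → Rˣ} {u : Pt → Rˣ}
    (hflat : ∀ p : Pt, p.1 + p.2.1 + p.2.2 ≤ 2 → u p = t (toFlat p))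
    (hu : ∀ x y z : ℤ, 0 ≤ x + y + z →
      (u (x, y, z) : R) * u (x + 1, y + 1, z + 1) =
        u (x + 1, y, z) * u (x, y + 1, z + 1) + u (x, y + 1, z) * u (x + 1, y, z + 1))
    {N : ℕ} {a b c : ℤ} (hN : 1 ≤ N) (habc : a + b + c = N + 2) :
    shadowFormula t N a b c = u (a, b, c) := by
  have hw := isOctahedral_apexData hu habc
  have hM := shadow_mul_rowsOf hflat habc hw (le_refl N)
  have hdet := cornerMinor_mul_prod_east (apexData u a b c) (shadowMatrix t N a b c) hM
  have h0 : u (a, b, c) = apexData u a b c 0 0 0 := by simp [apexData]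
  rw [shadowFormula, h0]
  set D := cornerMinor (shadowMatrix t N a b c)
  set w := apexData u a b c
  set σ : ℕ → Rˣ := fun i => vertexValue w (stripVertex N 0 i) with hσ
  set τ : ℕ → Rˣ := fun i => vertexValue w (stripVertex N N i) with hτ
  have hwest : ∏ i ∈ Finset.Icc (N + 2) (2 * N),
      (((t (toFlat (westVertex N a b c i)))⁻¹ : Rˣ) : R) =
      ((∏ i ∈ Finset.Icc (N + 2) (2 * N), σ i)⁻¹ : Rˣ) := by
    rw [← Finset.prod_inv_distrib, Units.coe_prod]
    refine Finset.prod_congr rfl fun i hi => ?_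
    rw [apply_westVertex hflat habc (by have := Finset.mem_Icc.1 hi; omega)]
    rfl
  have heast : ∏ j ∈ Finset.Icc (2 * N + 1) (3 * N), (t (toFlat (eastVertex N a b c j)) : R) =
      (∏ j ∈ Finset.Icc (2 * N + 1) (3 * N), τ j : Rˣ) := by
    rw [Units.coe_prod]
    refine Finset.prod_congr rfl fun i hi => ?_
    have := Finset.mem_Icc.1 hi
    rw [apply_eastVertex hflat habc (by omega) (by omega)]
    rfl
  -- the two products in the formula differ from those of the determinant identity by corner values
  have hσN : σ (2 * N + 1) = w N 0 0 := by
    simp only [hσ, vertexValue]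
    rw [stripVertex_west_le (by omega) le_rfl]
    congr 1 <;> dsimp only <;> omega
  have hτN : τ (2 * N + 1) = w 0 N 0 := by
    simp only [hτ, vertexValue]
    rw [stripVertex_east_le le_rfl]
    congr 1 <;> dsimp only <;> omega
  have hτ3N : τ (3 * N + 1) = w N N 0 := by
    simp only [hτ, vertexValue]
    rw [stripVertex_east_gt (by omega) le_rfl]
    congr 1 ; omega
  have hprodσ : ∏ i ∈ Finset.range N, σ (N + 2 + i) =
      (∏ i ∈ Finset.Icc (N + 2) (2 * N), σ i) * w N 0 0 := by
    rw [← hσN, ← Finset.prod_Icc_succ_top (by omega), ← Finset.Ico_succ_right_eq_Icc,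
      Finset.prod_Ico_eq_prod_range]
    congr 2
    simp; omega
  have hprodτ : (∏ j ∈ Finset.Icc (2 * N + 1) (3 * N), τ j) * w N N 0 =
      w 0 N 0 * ∏ j ∈ Finset.range N, τ (2 * N + 2 + j) := by
    rw [← hτN, ← hτ3N, ← Finset.prod_Icc_succ_top (by omega), ← Finset.Ico_succ_right_eq_Icc,
      Finset.prod_Ico_eq_prod_range, show Order.succ (3 * N + 1) - (2 * N + 1) = N + 1 by
        simp; omega, Finset.prod_range_succ', mul_comm]
    congr 1
    refine Finset.prod_congr rfl fun i _ => ?_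
    congr 1
    omega
  have hdet' : D * (∏ j ∈ Finset.range N, τ (2 * N + 2 + j) : Rˣ) =
      (∏ i ∈ Finset.range N, σ (N + 2 + i) : Rˣ) * faceRatio (w 0 0 0) (w N 0 0) (w 0 N 0)
        (w N N 0) := by
    rw [Units.coe_prod, Units.coe_prod]
    exact hdet
  rw [hwest, heast]
  rw [hprodσ] at hdet'
  generalize (∏ i ∈ Finset.Icc (N + 2) (2 * N), σ i) = P at *
  generalize (∏ j ∈ Finset.Icc (2 * N + 1) (3 * N), τ j) = Q at *
  generalize ∏ j ∈ Finset.range N, τ (2 * N + 2 + j) = T at *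
  have hD : D = ((P * w N 0 0 * (w 0 0 0 * w N N 0 * (w N 0 0)⁻¹ * (w 0 N 0)⁻¹) * T⁻¹ :
      Rˣ) : R) := by
    rw [Units.val_mul, Units.eq_mul_inv_iff_mul_eq, hdet', Units.val_mul (P * _)]
    rfl
  have hQ : Q = w 0 N 0 * T * (w N N 0)⁻¹ := by rw [← hprodτ, mul_inv_cancel_right]
  rw [hD, hQ, ← Units.val_mul, ← Units.val_mul]
  congr 1
  calc _ = w 0 0 0 * (P * P⁻¹) * (T * T⁻¹) * (w 0 N 0 * (w 0 N 0)⁻¹) * (w N 0 0 * (w N 0 0)⁻¹) *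
        (w N N 0 * (w N N 0)⁻¹) := by ac_rfl
    _ = _ := by simp

end

/-- The right-hand side of the formula commutes with ring homomorphisms. -/
theorem shadowFormula_map {R S : Type*} [CommRing R] [CommRing S] (f : R →+* S)
    (t : FlatPt → Rˣ) (N : ℕ) (a b c : ℤ) :
    f (shadowFormula t N a b c) =
      shadowFormula (fun p => Units.map f.toMonoidHom (t p)) N a b c := by
  have hL : ∀ L : Lozenge, f.mapMatrix (L.matrix t (3 * N)) =
      L.matrix (fun p => Units.map f.toMonoidHom (t p)) (3 * N) := by
    intro L
    ext i j
    simp only [Lozenge.matrix, embedAt, Vmat, RingHom.mapMatrix_apply, Matrix.map_apply,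
      Matrix.of_apply, apply_ite f]
    simp [← map_inv]
  have hM : f.mapMatrix (shadowMatrix t N a b c) =
      shadowMatrix (fun p => Units.map f.toMonoidHom (t p)) N a b c := by
    rw [shadowMatrix, shadowMatrix, map_list_prod, List.map_map]
    congr 2
    funext L
    exact hL L
  rw [shadowFormula, shadowFormula, ← hM, map_mul, map_mul, map_prod, map_prod]
  congr 1
  rw [cornerMinor, cornerMinor, RingHom.map_det]
  rfl

theorem cubeSolution_eq_shadowFormula_of_isUnit {R : Type*} [CommRing R] {t : FlatPt → Rˣ}
    {θ : ℤ → ℤ → ℤ → R} (hθ : IsCubeSolution t θ)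
    (hunit : ∀ x y z : ℤ, 0 ≤ x + y + z → IsUnit (θ x y z)) {N : ℕ} {a b c : ℤ} (hN : 1 ≤ N)
    (habc : a + b + c = N + 2) : θ a b c = shadowFormula t N a b c := by
  classical
  let u : Pt → Rˣ := fun p =>
    if h : 0 ≤ p.1 + p.2.1 + p.2.2 then (hunit _ _ _ h).unit else t (toFlat p)
  have hu : ∀ x y z : ℤ, 0 ≤ x + y + z → (u (x, y, z) : R) = θ x y z := fun x y z h => by
    simp [u, h]
  rw [shadowFormula_eq_apex (u := u) _ _ hN habc, hu _ _ _ (by omega)]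
  · intro p hp
    by_cases h : 0 ≤ p.1 + p.2.1 + p.2.2
    · ext
      rw [hu _ _ _ h]
      have hp3 : toFlat p = ⟨p, h, hp⟩ := by
        have : (p.1 + p.2.1 + p.2.2) / 3 = 0 := by omega
        ext <;> simp [toFlat, this]
      rw [hp3, ← hθ.1]
    · simp only [u, dif_neg h]
  · intro x y z h
    rw [hu _ _ _ h, hu _ _ _ (by omega), hu _ _ _ (by omega), hu _ _ _ (by omega),
      hu _ _ _ (by omega), hu _ _ _ (by omega)]
    exact hθ.2 x y z h

theorem cubeSolution_eq_shadowFormula {R : Type*} [CommRing R] {t : FlatPt → Rˣ}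
    {θ : ℤ → ℤ → ℤ → R} (hθ : IsCubeSolution t θ)
    (hreg : ∀ x y z : ℤ, 0 ≤ x + y + z → θ x y z ∈ nonZeroDivisors R) {N : ℕ} {a b c : ℤ}
    (hN : 1 ≤ N) (habc : a + b + c = N + 2) : θ a b c = shadowFormula t N a b c := by
  let f : R →+* Localization (nonZeroDivisors R) := algebraMap _ _
  have hf : Function.Injective f := IsLocalization.injective _ le_rfl
  apply hf
  rw [shadowFormula_map]
  refine cubeSolution_eq_shadowFormula_of_isUnit (θ := fun x y z => f (θ x y z)) ⟨?_, ?_⟩ ?_ hN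
    habc
  · intro p
    simp [hθ.1 p]
  · intro x y z h
    simp only [← map_mul, ← map_add, hθ.2 x y z h]
  · intro x y z h
    exact IsLocalization.map_units _ (⟨_, hreg x y z h⟩ : nonZeroDivisors R)

/-! ### Formal initial data -/

/-- A rational function which is a quotient of two polynomials that are positive at the point where
all variables are `1`. -/
def IsPositive (x : FormalField) : Prop :=
  ∃ f g : MvPolynomial FlatPt ℚ, 0 < MvPolynomial.eval 1 f ∧ 0 < MvPolynomial.eval 1 g ∧
    x * algebraMap _ FormalField g = algebraMap _ FormalField f

theorem algebraMap_formalField_ne_zero {g : MvPolynomial FlatPt ℚ}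
    (hg : 0 < MvPolynomial.eval 1 g) : algebraMap _ FormalField g ≠ 0 := by
  rw [map_ne_zero_iff _ (IsFractionRing.injective (MvPolynomial FlatPt ℚ) FormalField)]
  rintro rfl
  simp at hg

theorem IsPositive.ne_zero {x : FormalField} (hx : IsPositive x) : x ≠ 0 := by
  obtain ⟨f, g, hf, hg, h⟩ := hx
  rintro rfl
  rw [zero_mul] at h
  exact algebraMap_formalField_ne_zero hf h.symm

theorem IsPositive.add {x y : FormalField} (hx : IsPositive x) (hy : IsPositive y) :
    IsPositive (x + y) := by
  obtain ⟨f, g, hf, hg, h⟩ := hx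
  obtain ⟨f', g', hf', hg', h'⟩ := hy
  refine ⟨f * g' + f' * g, g * g', ?_, ?_, ?_⟩
  · rw [map_add, map_mul, map_mul]; positivity
  · rw [map_mul]; positivity
  · simp only [map_add, map_mul]
    linear_combination algebraMap _ FormalField g' * h + algebraMap _ FormalField g * h'

theorem IsPositive.mul {x y : FormalField} (hx : IsPositive x) (hy : IsPositive y) :
    IsPositive (x * y) := by
  obtain ⟨f, g, hf, hg, h⟩ := hx
  obtain ⟨f', g', hf', hg', h'⟩ := hy
  refine ⟨f * f', g * g', ?_, ?_, ?_⟩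
  · rw [map_mul]; positivity
  · rw [map_mul]; positivity
  · rw [map_mul, map_mul, ← h, ← h']; ring

theorem IsPositive.of_mul_left {x y : FormalField} (hx : IsPositive x)
    (hxy : IsPositive (x * y)) : IsPositive y := by
  obtain ⟨f, g, hf, hg, h⟩ := hx
  obtain ⟨f', g', hf', hg', h'⟩ := hxy
  refine ⟨f' * g, g' * f, ?_, ?_, ?_⟩
  · rw [map_mul]; positivity
  · rw [map_mul]; positivity
  · rw [map_mul, map_mul, ← h, ← h']; ring

theorem isPositive_formalData (p : FlatPt) : IsPositive (formalData p) := by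
  refine ⟨MvPolynomial.X p, 1, ?_, ?_, ?_⟩ <;> simp [formalData]

theorem IsCubeSolution.isPositive {θ : ℤ → ℤ → ℤ → FormalField}
    (hθ : IsCubeSolution formalData θ) (n : ℕ) :
    ∀ x y z : ℤ, x + y + z = n → IsPositive (θ x y z) := by
  induction n using Nat.strong_induction_on with
  | _ n ih =>
    intro x y z h
    by_cases hn : n ≤ 2
    · rw [hθ.1 ⟨(x, y, z), by dsimp only; omega, by dsimp only; omega⟩]
      exact isPositive_formalData _
    · have hrec := hθ.2 (x - 1) (y - 1) (z - 1) (by omega)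
      simp only [sub_add_cancel] at hrec
      refine (ih (n - 3) (by omega) (x - 1) (y - 1) (z - 1) (by omega)).of_mul_left ?_
      rw [hrec]
      exact ((ih (n - 2) (by omega) _ _ _ (by omega)).mul
        (ih (n - 1) (by omega) _ _ _ (by omega))).add
        ((ih (n - 2) (by omega) _ _ _ (by omega)).mul (ih (n - 1) (by omega) _ _ _ (by omega)))

/-- The solution by division of the octahedron equation on the level `x + y + z = n`. The level is a
separate argument, and the value is meaningful only where it agrees with `x + y + z`. -/
noncomputable def levelSolution {K : Type*} [Field K] (t : FlatPt → Kˣ) : ℕ → ℤ → ℤ → ℤ → K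
  | 0, x, y, z | 1, x, y, z | 2, x, y, z => t (toFlat (x, y, z))
  | n + 3, x, y, z =>
    (levelSolution t (n + 1) x (y - 1) (z - 1) * levelSolution t (n + 2) (x - 1) y z +
      levelSolution t (n + 1) (x - 1) y (z - 1) * levelSolution t (n + 2) x (y - 1) z) /
      levelSolution t n (x - 1) (y - 1) (z - 1)

theorem isPositive_levelSolution (n : ℕ) :
    ∀ x y z : ℤ, IsPositive (levelSolution formalData n x y z) := by
  induction n using Nat.strong_induction_on with
  | _ n ih =>
    intro x y z
    match n, ih with
    | 0, _ | 1, _ | 2, _ => exact isPositive_formalData _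
    | n + 3, ih =>
      have h0 := ih n (by omega) (x - 1) (y - 1) (z - 1)
      refine h0.of_mul_left ?_
      rw [levelSolution, mul_div_cancel₀ _ h0.ne_zero]
      exact ((ih (n + 1) (by omega) _ _ _).mul (ih (n + 2) (by omega) _ _ _)).add
        ((ih (n + 1) (by omega) _ _ _).mul (ih (n + 2) (by omega) _ _ _))

theorem exists_isCubeSolution_formalData :
    ∃ θ : ℤ → ℤ → ℤ → FormalField, IsCubeSolution formalData θ := by
  refine ⟨fun x y z => levelSolution formalData (x + y + z).toNat x y z, ?_, ?_⟩
  · rintro ⟨⟨x, y, z⟩, h0, h2⟩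
    dsimp only at h0 h2 ⊢
    have hp : toFlat (x, y, z) = ⟨(x, y, z), h0, h2⟩ := by
      have : (x + y + z) / 3 = 0 := by omega
      ext <;> simp [toFlat, this]
    rw [← hp]
    obtain h | h | h : (x + y + z).toNat = 0 ∨ (x + y + z).toNat = 1 ∨ (x + y + z).toNat = 2 := by
      omega
    all_goals rw [h, levelSolution]
  · intro x y z h
    obtain ⟨n, hn⟩ : ∃ n : ℕ, x + y + z = n := ⟨(x + y + z).toNat, by omega⟩
    have e0 : (x + y + z).toNat = n := by omega
    have e1 : (x + 1 + y + z).toNat = n + 1 := by omega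
    have e2 : (x + (y + 1) + z).toNat = n + 1 := by omega
    have e3 : (x + (y + 1) + (z + 1)).toNat = n + 2 := by omega
    have e4 : (x + 1 + y + (z + 1)).toNat = n + 2 := by omega
    have e5 : (x + 1 + (y + 1) + (z + 1)).toNat = n + 3 := by omega
    simp only [e0, e1, e2, e3, e4, e5]
    rw [levelSolution]
    simp only [add_sub_cancel_right]
    exact mul_div_cancel₀ _ (isPositive_levelSolution n x y z).ne_zero

theorem mainTheorem2 :
    (∀ (R : Type*) [CommRing R] (t : FlatPt → Rˣ) (θ : ℤ → ℤ → ℤ → R),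
      IsCubeSolution t θ →
      (∀ x y z : ℤ, 0 ≤ x + y + z → θ x y z ∈ nonZeroDivisors R) →
      ∀ (N : ℕ) (a b c : ℤ), 1 ≤ N → a + b + c = N + 2 →
        θ a b c = shadowFormula t N a b c) ∧
    (∃ θ : ℤ → ℤ → ℤ → FormalField, IsCubeSolution formalData θ) ∧
    (∀ θ : ℤ → ℤ → ℤ → FormalField, IsCubeSolution formalData θ →
      ∀ (N : ℕ) (a b c : ℤ), 1 ≤ N → a + b + c = N + 2 →
        θ a b c = shadowFormula formalData N a b c) := by
  refine ⟨fun R _ t θ hθ hreg N a b c hN habc => cubeSolution_eq_shadowFormula hθ hreg hN habc,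
    exists_isCubeSolution_formalData, fun θ hθ N a b c hN habc =>
      cubeSolution_eq_shadowFormula_of_isUnit hθ (fun x y z h => ?_) hN habc⟩
  exact (hθ.isPositive (x + y + z).toNat x y z (by omega)).ne_zero.isUnit
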